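/- Fix the scalar field $\mathbb K\in\{\mathbb R,\mathbb C\}$; operators are bounded linear maps between Banach spaces over $\mathbb K$. Let $E$ be a Banach space with dual $E^*$ and dual unit ball $B_{E^*}$. For $K\subseteq E^*$ and $\varepsilon>0$ let $s_\varepsilon(K)$ be the set of all $x\in K$ such that the norm diameter of $K\cap V$ is greater than $\varepsilon$ for every weak$^*$-open $V\ni x$. Put $s^0_\varepsilon(K)=K$, $s^{\beta+1}_\varepsilon(K)=s_\varepsilon(s^\beta_\varepsilon(K))$, and $s^\beta_\varepsilon(K)=\bigcap_{\gamma<\beta}s^\gamma_\varepsilon(K)$ for limit ordinals $\beta$. For an ordinal $\alpha$, let $\mathrm{Pzl}^0_\alpha$ be the class of Banach spaces $E$ for which there are $c\in(0,1)$ and $p\ge 1$ such that $s^{\omega^\alpha}_\varepsilon(B_{E^*})\subseteq(1-c\varepsilon^p)B_{E^*}$ for all $\varepsilon\in(0,1)$; let $\mathrm{Pzl}_\alpha$ be the class of Banach spaces linearly isomorphic to a space in $\mathrm{Pzl}^0_\alpha$; and let $\mathrm{Op}(\mathrm{Pzl}_\alpha)$ be the class of operators $T:E\to F$ between Banach spaces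 that can be written $T=BA$ with operators $A:E\to D$, $B:D\to F$ and $D\in\mathrm{Pzl}_\alpha$. A class $\mathscr I$ of operators, with components $\mathscr I(E,F)$ consisting of its members $E\to F$, is an operator ideal if the identity of $\mathbb K$ belongs to $\mathscr I$, each $\mathscr I(E,F)$ is closed under addition, and $VTU\in\mathscr I$ whenever $T\in\mathscr I$ and $U,V$ are operators for which the composition is defined. It is closed if each $\mathscr I(E,F)$ is closed in the operator norm. **Theorem.** For every ordinal $\alpha$, the class $\mathrm{Op}(\mathrm{Pzl}_\alpha)$ is an operator ideal and it is not closed. -/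

import Mathlib

open Set

universe u

noncomputable section

namespace Szlenk

section Derivation

variable {𝕜 : Type} [RCLike 𝕜] {E : Type u} [NormedAddCommGroup E] [NormedSpace 𝕜 E]

/-- The derived set `s_ε(K)` of a set `K` in the dual of `E`: the points `x` of `K` such that
`K ∩ V` has norm diameter greater than `ε` for every weak-star open set `V` containing `x`. -/
def derivative (ε : ℝ) (K : Set (StrongDual 𝕜 E)) : Set (StrongDual 𝕜 E) :=
  {x | x ∈ K ∧ ∀ V : Set (WeakDual 𝕜 E), IsOpen V → StrongDual.toWeakDual x ∈ V →
    ENNReal.ofReal ε < Metric.ediam (K ∩ StrongDual.toWeakDual ⁻¹' V)}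

/-- The transfinite iterates `s_ε^β(K)`: `K` for `β = 0`, the derived set of the previous iterate
at a successor, the intersection of all earlier iterates at a limit. -/
def iterDerivative (ε : ℝ) (K : Set (StrongDual 𝕜 E)) (β : Ordinal.{u}) :
    Set (StrongDual 𝕜 E) :=
  Ordinal.limitRecOn β K (fun _ L => derivative ε L)
    (fun o _ L => ⋂ (γ : Ordinal.{u}) (h : γ < o), L γ h)

theorem iterDerivative_zero (ε : ℝ) (K : Set (StrongDual 𝕜 E)) :
    iterDerivative ε K 0 = K := by
  simp [iterDerivative]

theorem iterDerivative_succ (ε : ℝ) (K : Set (StrongDual 𝕜 E)) (β : Ordinal.{u}) :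
    iterDerivative ε K (Order.succ β) = derivative ε (iterDerivative ε K β) := by
  simp [iterDerivative]

theorem iterDerivative_limit (ε : ℝ) (K : Set (StrongDual 𝕜 E)) {β : Ordinal.{u}}
    (hβ : Order.IsSuccLimit β) :
    iterDerivative ε K β = ⋂ (γ : Ordinal.{u}) (_ : γ < β), iterDerivative ε K γ := by
  simp [iterDerivative, Ordinal.limitRecOn_limit, hβ]

end Derivation

section Classes

variable (𝕜 : Type) [RCLike 𝕜]

/-- A class of Banach spaces over `𝕜`. -/
abbrev SpaceClass : Type (u + 1) :=
  ∀ (E : Type u) [NormedAddCommGroup E] [NormedSpace 𝕜 E] [CompleteSpace E], Prop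

/-- A class of bounded linear operators between Banach spaces over `𝕜`, given by its components,
the component at `(E, F)` being a set of operators from `E` to `F`. -/
abbrev OperatorClass : Type (u + 1) :=
  ∀ (E F : Type u) [NormedAddCommGroup E] [NormedSpace 𝕜 E] [CompleteSpace E]
    [NormedAddCommGroup F] [NormedSpace 𝕜 F] [CompleteSpace F], Set (E →L[𝕜] F)

/-- The spaces `E` for which there are `c ∈ (0, 1)` and `p ≥ 1` such that
`s_ε^{ω^α}(B) ⊆ (1 - c ε^p) B` for all `ε ∈ (0, 1)`, where `B` is the closed unit ball of the dual
of `E`; as `1 - c ε^p > 0`, the right-hand side is the closed ball of radius `1 - c ε^p`. -/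
def Pzl₀ (α : Ordinal.{u}) : SpaceClass.{u} 𝕜 := fun E _ _ _ =>
  ∃ c ∈ Ioo (0 : ℝ) 1, ∃ p : ℝ, 1 ≤ p ∧ ∀ ε ∈ Ioo (0 : ℝ) 1,
    iterDerivative ε (Metric.closedBall (0 : StrongDual 𝕜 E) 1) (Ordinal.omega0 ^ α) ⊆
      Metric.closedBall 0 (1 - c * ε ^ p)

/-- The spaces that are linearly isomorphic to a space in `Pzl₀`. -/
def Pzl (α : Ordinal.{u}) : SpaceClass.{u} 𝕜 := fun E _ _ _ =>
  ∃ (F : Type u) (_ : NormedAddCommGroup F) (_ : NormedSpace 𝕜 F) (_ : CompleteSpace F),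
    Pzl₀ 𝕜 α F ∧ Nonempty (E ≃L[𝕜] F)

variable {𝕜}

/-- The operators that factor through a space of the class `P`. -/
def Op (P : SpaceClass.{u} 𝕜) : OperatorClass.{u} 𝕜 := fun E F _ _ _ _ _ _ =>
  {T | ∃ (D : Type u) (_ : NormedAddCommGroup D) (_ : NormedSpace 𝕜 D) (_ : CompleteSpace D)
    (A : E →L[𝕜] D) (B : D →L[𝕜] F), P D ∧ T = B.comp A}

/-- Operator ideals. The scalar field is lifted to the universe of the Banach spaces. -/
structure IsOperatorIdeal (I : OperatorClass.{u} 𝕜) : Prop where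
  id_mem : ContinuousLinearMap.id 𝕜 (ULift.{u} 𝕜) ∈ I (ULift.{u} 𝕜) (ULift.{u} 𝕜)
  add_mem : ∀ (E F : Type u) [NormedAddCommGroup E] [NormedSpace 𝕜 E] [CompleteSpace E]
    [NormedAddCommGroup F] [NormedSpace 𝕜 F] [CompleteSpace F] (S T : E →L[𝕜] F),
    S ∈ I E F → T ∈ I E F → S + T ∈ I E F
  comp_mem : ∀ (D E F G : Type u) [NormedAddCommGroup D] [NormedSpace 𝕜 D] [CompleteSpace D]
    [NormedAddCommGroup E] [NormedSpace 𝕜 E] [CompleteSpace E]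
    [NormedAddCommGroup F] [NormedSpace 𝕜 F] [CompleteSpace F]
    [NormedAddCommGroup G] [NormedSpace 𝕜 G] [CompleteSpace G]
    (U : D →L[𝕜] E) (T : E →L[𝕜] F) (V : F →L[𝕜] G),
    T ∈ I E F → V.comp (T.comp U) ∈ I D G

/-- A class of operators is closed if each of its components is closed in the operator norm. -/
def IsClosedClass (I : OperatorClass.{u} 𝕜) : Prop :=
  ∀ (E F : Type u) [NormedAddCommGroup E] [NormedSpace 𝕜 E] [CompleteSpace E]
    [NormedAddCommGroup F] [NormedSpace 𝕜 F] [CompleteSpace F], IsClosed (I E F)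

end Classes

end Szlenk

end

/-! Measure a dual ball by the number of blocks of `ω ^ α` derivations it survives. For a space in
`Pzl₀` each block multiplies the radius by at most `1 - c ε^p`, and a ball of radius below `ε / 2`
dies in the next block, so that polynomially many blocks in `1 / ε` exhaust the ball
(`Pzl₀.exists_szlenkSet_eq_empty`). Exhaustion within so many blocks passes to spaces through which
a multiple of the identity factors: if `s • id` on `F` factors through a fixed space of the class
with bounded factors, the dual ball of `F` is exhausted, at fixed `ε`, in polynomially many blocks
in `1 / s` (`Pzl.exists_szlenkSet_eq_empty`).

Sums of operators factor through products, so the ideal property rests on `Pzl₀.prod`. An `ε`-far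
pair in the dual of a product is `ε / 2`-far in one coordinate, and `iterDerive_or_subset` says that
`ω ^ α` derivations for a union of two relations leave only what `ω ^ α` derivations for one of them
leave. This is a form of the additive indecomposability of `ω ^ α`.

Closedness fails because the degree of the polynomial is not bounded under norm limits. There is a
space in `Pzl₀` whose dual ball outlives one block (`exists_pzl₀_zero_mem`, by `ℓ²`-sums over all
smaller ordinals); its `ℓ¹`-powers outlive any prescribed finite number of blocks. Take `F n`
outliving `2 ^ (n²)` blocks and let `T` act on the `ℓ²`-sum of the `F n` as `2 ^ (-n)` on the `n`-th
summand. `T` is a norm limit of members of the ideal, but a factorization of `T` would bound `2 ^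
(n²)` by a polynomial in `2 ^ n`. -/

namespace Szlenk

/-! ### Derivations of topological spaces defined by a relation -/

section Abstract

universe v w

variable {X : Type v} [TopologicalSpace X]

/-- The derivation determined by a relation `r`: the points of `K` all of whose neighbourhoods
contain two `r`-related points of `K`. -/
def derive (r : X → X → Prop) (K : Set X) : Set X :=
  {x | x ∈ K ∧ ∀ V : Set X, IsOpen V → x ∈ V → ∃ y ∈ K ∩ V, ∃ z ∈ K ∩ V, r y z}

/-- The transfinite iterates of `derive r`. -/
noncomputable def iterDerive (r : X → X → Prop) (K : Set X) (β : Ordinal.{u}) : Set X :=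
  Ordinal.limitRecOn β K (fun _ L => derive r L)
    (fun o _ L => ⋂ (γ : Ordinal.{u}) (h : γ < o), L γ h)

theorem iterDerive_zero (r : X → X → Prop) (K : Set X) :
    iterDerive r K (0 : Ordinal.{u}) = K := by
  simp [iterDerive]

theorem iterDerive_succ (r : X → X → Prop) (K : Set X) (β : Ordinal.{u}) :
    iterDerive r K (Order.succ β) = derive r (iterDerive r K β) := by
  simp [iterDerive]

theorem iterDerive_limit (r : X → X → Prop) (K : Set X) {β : Ordinal.{u}}
    (hβ : Order.IsSuccLimit β) :
    iterDerive r K β = ⋂ (γ : Ordinal.{u}) (_ : γ < β), iterDerive r K γ := by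
  simp [iterDerive, Ordinal.limitRecOn_limit, hβ]

theorem iterDerive_one (r : X → X → Prop) (K : Set X) :
    iterDerive r K (1 : Ordinal.{u}) = derive r K := by
  rw [← zero_add (1 : Ordinal.{u}), ← Order.succ_eq_add_one, iterDerive_succ, iterDerive_zero]

theorem derive_subset (r : X → X → Prop) (K : Set X) : derive r K ⊆ K := fun _ hx => hx.1

theorem iterDerive_antitone (r : X → X → Prop) (K : Set X) :
    Antitone (iterDerive r K : Ordinal.{u} → Set X) := by
  intro γ β
  induction β using Ordinal.limitRecOn with
  | zero => intro h; rw [nonpos_iff_eq_zero.1 h]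
  | add_one β ih =>
    intro h
    rcases h.eq_or_lt with rfl | h
    · exact le_rfl
    · rw [← Order.succ_eq_add_one, iterDerive_succ]
      exact (derive_subset r _).trans (ih (Order.lt_add_one_iff.1 h))
  | limit β hβ _ =>
    intro h
    rcases h.eq_or_lt with rfl | h
    · exact le_rfl
    · rw [iterDerive_limit r K hβ]
      exact iInter₂_subset γ h

theorem iterDerive_subset (r : X → X → Prop) (K : Set X) (β : Ordinal.{u}) :
    iterDerive r K β ⊆ K := by
  simpa [iterDerive_zero] using iterDerive_antitone r K (zero_le (a := β))

theorem iterDerive_add (r : X → X → Prop) (K : Set X) (γ β : Ordinal.{u}) :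
    iterDerive r K (γ + β) = iterDerive r (iterDerive r K γ) β := by
  induction β using Ordinal.limitRecOn with
  | zero => rw [add_zero, iterDerive_zero]
  | add_one β ih =>
    rw [← add_assoc, ← Order.succ_eq_add_one, ← Order.succ_eq_add_one, iterDerive_succ,
      iterDerive_succ, ih]
  | limit β hβ ih =>
    rw [iterDerive_limit _ _ hβ]
    apply Subset.antisymm
    · refine subset_iInter₂ fun δ hδ => ?_
      rw [← ih δ hδ]
      exact iterDerive_antitone r K (add_le_add_right hδ.le γ)
    · rw [iterDerive_limit r K (Ordinal.isSuccLimit_add γ hβ)]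
      refine subset_iInter₂ fun δ hδ => ?_
      obtain ⟨ε, hε, hle⟩ := (Ordinal.lt_add_iff_of_isSuccLimit hβ).1 hδ
      refine (iInter₂_subset ε hε).trans ?_
      rw [← ih ε hε]
      exact iterDerive_antitone r K hle.le

/-- A continuous map which, on an open set, preserves relations also preserves derived sets. -/
theorem mapsTo_iterDerive {Y : Type w} [TopologicalSpace Y] {r : X → X → Prop}
    {s : Y → Y → Prop} {K U : Set X} {L : Set Y} {f : X → Y} (hf : Continuous f) (hU : IsOpen U)
    (hKL : MapsTo f (K ∩ U) L) (hrs : ∀ y ∈ K ∩ U, ∀ z ∈ K ∩ U, r y z → s (f y) (f z))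
    (β : Ordinal.{u}) : MapsTo f (iterDerive r K β ∩ U) (iterDerive s L β) := by
  induction β using Ordinal.limitRecOn with
  | zero => simpa [iterDerive_zero] using hKL
  | add_one β ih =>
    rw [← Order.succ_eq_add_one, iterDerive_succ, iterDerive_succ]
    rintro x ⟨⟨hx, hV⟩, hxU⟩
    refine ⟨ih ⟨hx, hxU⟩, fun V hVo hxV => ?_⟩
    obtain ⟨y, ⟨hy, hyV, hyU⟩, z, ⟨hz, hzV, hzU⟩, hyz⟩ :=
      hV (f ⁻¹' V ∩ U) ((hVo.preimage hf).inter hU) ⟨hxV, hxU⟩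
    exact ⟨f y, ⟨ih ⟨hy, hyU⟩, hyV⟩, f z, ⟨ih ⟨hz, hzU⟩, hzV⟩,
      hrs y ⟨iterDerive_subset r K β hy, hyU⟩ z ⟨iterDerive_subset r K β hz, hzU⟩ hyz⟩
  | limit β hβ ih =>
    rw [iterDerive_limit s L hβ]
    rintro x ⟨hx, hxU⟩
    exact mem_iInter₂.2 fun γ hγ => ih γ hγ ⟨iterDerive_antitone r K hγ.le hx, hxU⟩

theorem mapsTo_iterDerive_univ {Y : Type w} [TopologicalSpace Y] {r : X → X → Prop}
    {s : Y → Y → Prop} {K : Set X} {L : Set Y} {f : X → Y} (hf : Continuous f)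
    (hKL : MapsTo f K L) (hrs : ∀ y ∈ K, ∀ z ∈ K, r y z → s (f y) (f z))
    (β : Ordinal.{u}) : MapsTo f (iterDerive r K β) (iterDerive s L β) := by
  simpa using mapsTo_iterDerive (U := univ) hf isOpen_univ (by simpa using hKL)
    (by simpa using hrs) β

theorem iterDerive_mono {r : X → X → Prop} {K L : Set X} (h : K ⊆ L) (β : Ordinal.{u}) :
    iterDerive r K β ⊆ iterDerive r L β :=
  mapsTo_iterDerive_univ continuous_id h (fun _ _ _ _ => id) β

/-- Derived sets are relatively closed. -/
theorem exists_isOpen_disjoint_iterDerive {r : X → X → Prop} {K : Set X} {x : X}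
    (hxK : x ∈ K) {β : Ordinal.{u}} (hx : x ∉ iterDerive r K β) :
    ∃ U, IsOpen U ∧ x ∈ U ∧ ∀ y ∈ U, y ∉ iterDerive r K β := by
  induction β using Ordinal.limitRecOn with
  | zero => rw [iterDerive_zero] at hx; exact absurd hxK hx
  | add_one β ih =>
    rw [← Order.succ_eq_add_one, iterDerive_succ] at hx ⊢
    by_cases hxβ : x ∈ iterDerive r K β
    · have : ¬ ∀ V : Set X, IsOpen V → x ∈ V →
          ∃ y ∈ iterDerive r K β ∩ V, ∃ z ∈ iterDerive r K β ∩ V, r y z :=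
        fun h => hx ⟨hxβ, h⟩
      push Not at this
      obtain ⟨V, hV, hxV, hr⟩ := this
      refine ⟨V, hV, hxV, fun y hyV hy => ?_⟩
      obtain ⟨a, ha, b, hb, hab⟩ := hy.2 V hV hyV
      exact hr a ha b hb hab
    · obtain ⟨U, hU, hxU, h⟩ := ih hxβ
      exact ⟨U, hU, hxU, fun y hy hy' => h y hy hy'.1⟩
  | limit β hβ ih =>
    rw [iterDerive_limit r K hβ] at hx
    simp only [mem_iInter, not_forall] at hx
    obtain ⟨γ, hγ, hx⟩ := hx
    obtain ⟨U, hU, hxU, h⟩ := ih γ hγ hx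
    exact ⟨U, hU, hxU, fun y hy hy' => h y hy (iterDerive_antitone r K hγ.le hy')⟩

theorem iterDerive_inter_isOpen_subset {r : X → X → Prop} {K U : Set X} (hU : IsOpen U)
    (β : Ordinal.{u}) : iterDerive r K β ∩ U ⊆ iterDerive r (K ∩ U) β :=
  mapsTo_iterDerive continuous_id hU (fun _ => id) (fun _ _ _ _ => id) β

/-- Induction on `N`. Near `x` the blocks `i + 1` for `r₁` and `j + 1` for `r₂` are already empty,
since derived sets are relatively closed. The induction hypothesis then puts the `N`-th `r`-block
near `x` inside both the `i`-th `r₁`-block and the `j`-th `r₂`-block. If `x` survived one more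
block, `ho` would make it survive one more for `r₁` or `r₂`. -/
theorem notMem_iterDerive_mul_add {r r₁ r₂ : X → X → Prop} {o : Ordinal.{u}}
    (ho : ∀ K : Set X, iterDerive r K o ⊆ iterDerive r₁ K o ∪ iterDerive r₂ K o)
    (K : Set X) (N : ℕ) : ∀ m n : ℕ, m + n = N → ∀ x, x ∉ iterDerive r₁ K (o * m) →
      x ∉ iterDerive r₂ K (o * n) → x ∉ iterDerive r K (o * N) := by
  have hsucc : ∀ (q : X → X → Prop) (k : ℕ),
      iterDerive q K (o * (k + 1 : ℕ)) = iterDerive q (iterDerive q K (o * k)) o := by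
    intro q k
    rw [Nat.cast_succ, mul_add_one, iterDerive_add]
  have hanti : ∀ (q : X → X → Prop) (k : ℕ),
      iterDerive q K (o * (k + 1 : ℕ)) ⊆ iterDerive q K (o * k) := by
    intro q k
    rw [hsucc]
    exact iterDerive_subset _ _ _
  induction N with
  | zero =>
    intro m n hmn x hx
    obtain rfl : m = 0 := by omega
    simp only [Nat.cast_zero, mul_zero, iterDerive_zero] at hx ⊢
    exact fun _ => hx
  | succ N ih =>
    intro m n hmn x hx₁ hx₂ hx
    have hxK : x ∈ K := iterDerive_subset _ _ _ hx
    rcases m with _ | i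
    · simp [iterDerive_zero, hxK] at hx₁
    rcases n with _ | j
    · simp [iterDerive_zero, hxK] at hx₂
    obtain ⟨U₁, hU₁, hxU₁, h₁⟩ := exists_isOpen_disjoint_iterDerive hxK hx₁
    obtain ⟨U₂, hU₂, hxU₂, h₂⟩ := exists_isOpen_disjoint_iterDerive hxK hx₂
    have hsub : iterDerive r K (o * N) ∩ (U₁ ∩ U₂) ⊆
        iterDerive r₁ K (o * i) ∩ iterDerive r₂ K (o * j) := by
      rintro y ⟨hy, hyU₁, hyU₂⟩
      constructor
      · by_contra hy'
        exact ih i (j + 1) (by omega) y hy' (h₂ y hyU₂) hy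
      · by_contra hy'
        exact ih (i + 1) j (by omega) y (h₁ y hyU₁) hy' hy
    rw [hsucc] at hx hx₁ hx₂
    have hx' := ho _ (iterDerive_mono hsub o
      (iterDerive_inter_isOpen_subset (hU₁.inter hU₂) o ⟨hx, hxU₁, hxU₂⟩))
    rcases hx' with hx' | hx'
    · exact hx₁ (iterDerive_mono inter_subset_left o hx')
    · exact hx₂ (iterDerive_mono inter_subset_right o hx')

theorem iterDerive_limit_notMem {r : X → X → Prop} {K : Set X} {α : Ordinal.{u}} (hα : α ≠ 0)
    {x : X} (hx : x ∉ iterDerive r K (Ordinal.omega0 ^ α)) :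
    ∃ c < α, ∃ n : ℕ, x ∉ iterDerive r K (Ordinal.omega0 ^ c * n) := by
  rw [iterDerive_limit r K (Ordinal.isSuccLimit_opow_left Ordinal.isSuccLimit_omega0 hα)] at hx
  simp only [mem_iInter, not_forall] at hx
  obtain ⟨γ, hγ, hx⟩ := hx
  obtain ⟨c, hc, n, hn⟩ := (Ordinal.lt_omega0_opow hα).1 hγ
  exact ⟨c, hc, n, fun h => hx (iterDerive_antitone r K hn.le h)⟩

/-- A point removed before stage `ω ^ α` by both relations is removed by stages `ω ^ c * n₁` and `ω
^ c * n₂` for a common `c < α`; hence the union removes it by `ω ^ c * (n₁ + n₂)`, still below `ω ^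
α`. -/
theorem iterDerive_or_subset {r r₁ r₂ : X → X → Prop} (hr : ∀ y z, r y z → r₁ y z ∨ r₂ y z)
    (α : Ordinal.{u}) : ∀ K : Set X, iterDerive r K (Ordinal.omega0 ^ α) ⊆
      iterDerive r₁ K (Ordinal.omega0 ^ α) ∪ iterDerive r₂ K (Ordinal.omega0 ^ α) := by
  induction α using WellFoundedLT.induction with
  | ind α ih =>
  intro K x hx
  by_contra hx'
  simp only [mem_union, not_or] at hx'
  obtain ⟨hx₁, hx₂⟩ := hx'
  rcases eq_or_ne α 0 with rfl | hα
  · rw [Ordinal.opow_zero] at hx hx₁ hx₂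
    obtain ⟨U₁, hU₁, hxU₁, h₁⟩ := exists_isOpen_disjoint_iterDerive (iterDerive_subset _ _ _ hx) hx₁
    obtain ⟨U₂, hU₂, hxU₂, h₂⟩ := exists_isOpen_disjoint_iterDerive (iterDerive_subset _ _ _ hx) hx₂
    have hx' := iterDerive_inter_isOpen_subset (hU₁.inter hU₂) 1 ⟨hx, hxU₁, hxU₂⟩
    rw [iterDerive_one] at hx' hx₁ hx₂
    have hxK := hx'.1.1
    have n₁ : ¬ ∀ V : Set X, IsOpen V → x ∈ V → ∃ y ∈ K ∩ V, ∃ z ∈ K ∩ V, r₁ y z :=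
      fun h => hx₁ ⟨hxK, h⟩
    have n₂ : ¬ ∀ V : Set X, IsOpen V → x ∈ V → ∃ y ∈ K ∩ V, ∃ z ∈ K ∩ V, r₂ y z :=
      fun h => hx₂ ⟨hxK, h⟩
    push Not at n₁ n₂
    obtain ⟨V₁, hV₁, hxV₁, g₁⟩ := n₁
    obtain ⟨V₂, hV₂, hxV₂, g₂⟩ := n₂
    obtain ⟨y, ⟨hy, hyV⟩, z, ⟨hz, hzV⟩, hyz⟩ := hx'.2 (V₁ ∩ V₂) (hV₁.inter hV₂) ⟨hxV₁, hxV₂⟩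
    rcases hr y z hyz with h | h
    · exact g₁ y ⟨hy.1, hyV.1⟩ z ⟨hz.1, hzV.1⟩ h
    · exact g₂ y ⟨hy.1, hyV.2⟩ z ⟨hz.1, hzV.2⟩ h
  · obtain ⟨c₁, hc₁, n₁, h₁⟩ := iterDerive_limit_notMem hα hx₁
    obtain ⟨c₂, hc₂, n₂, h₂⟩ := iterDerive_limit_notMem hα hx₂
    have hle : ∀ c ≤ max c₁ c₂, ∀ n : ℕ,
        Ordinal.omega0 ^ c * n ≤ Ordinal.omega0 ^ (max c₁ c₂) * n := fun c hc n =>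
      mul_le_mul_left (Ordinal.opow_le_opow_right Ordinal.omega0_pos hc) _
    refine notMem_iterDerive_mul_add (ih (max c₁ c₂) (max_lt hc₁ hc₂)) K (n₁ + n₂) n₁ n₂ rfl x
      (fun h => h₁ (iterDerive_antitone _ _ (hle c₁ (le_max_left _ _) n₁) h))
      (fun h => h₂ (iterDerive_antitone _ _ (hle c₂ (le_max_right _ _) n₂) h))
      (iterDerive_antitone _ _ ?_ hx)
    -- The extra `1` gives the strict inequality demanded by `Ordinal.lt_omega0_opow`.
    exact ((Ordinal.lt_omega0_opow hα).2 ⟨max c₁ c₂, max_lt hc₁ hc₂, n₁ + n₂ + 1, by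
      push_cast
      exact (mul_lt_mul_iff_right₀ (Ordinal.opow_pos _ Ordinal.omega0_pos)).2
        (by exact_mod_cast Nat.lt_succ_self _)⟩).le

theorem exists_mem_iterDerive_of_finset {ι : Type*} (s : Finset ι) (r : ι → X → X → Prop)
    {K : Set X} {α : Ordinal.{u}} {x : X}
    (hx : x ∈ iterDerive (fun y z => ∃ i ∈ s, r i y z) K (Ordinal.omega0 ^ α)) :
    ∃ i ∈ s, x ∈ iterDerive (r i) K (Ordinal.omega0 ^ α) := by
  classical
  induction s using Finset.induction_on with
  | empty =>
    have h1 : (1 : Ordinal.{u}) ≤ Ordinal.omega0 ^ α :=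
      Order.one_le_iff_pos.2 (Ordinal.opow_pos _ Ordinal.omega0_pos)
    have := iterDerive_antitone _ _ h1 hx
    rw [iterDerive_one] at this
    obtain ⟨y, -, z, -, h⟩ := this.2 univ isOpen_univ trivial
    simp at h
  | insert a s _ ih =>
    have := iterDerive_or_subset (r₁ := r a) (r₂ := fun y z => ∃ i ∈ s, r i y z)
      (fun y z => by simp) α K hx
    rcases this with h | h
    · exact ⟨a, Finset.mem_insert_self _ _, h⟩
    · obtain ⟨i, hi, h⟩ := ih h
      exact ⟨i, Finset.mem_insert_of_mem hi, h⟩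

end Abstract

end Szlenk

namespace Szlenk

/-! ### Weak-star derivations of dual balls -/

section WeakStar

variable {𝕜 : Type} [RCLike 𝕜] {E : Type u} [NormedAddCommGroup E] [NormedSpace 𝕜 E]
  {F : Type u} [NormedAddCommGroup F] [NormedSpace 𝕜 F]

/-- The dual norm on the weak-star dual. -/
noncomputable def wnorm (f : WeakDual 𝕜 E) : ℝ := ‖WeakDual.toStrongDual f‖

/-- Two functionals are `ε`-far if their norm distance exceeds `ε`. -/
def far (ε : ℝ) (f g : WeakDual 𝕜 E) : Prop := ε < wnorm (f - g)

variable (𝕜 E) in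
/-- The iterated `ε`-derivatives of the dual ball of radius `ρ`. -/
noncomputable def szlenkSet (ε ρ : ℝ) (β : Ordinal.{u}) : Set (WeakDual 𝕜 E) :=
  iterDerive (far ε) {f | wnorm f ≤ ρ} β

/-- The adjoint of an operator, as a map between weak-star duals. -/
noncomputable def adj (A : E →L[𝕜] F) (f : WeakDual 𝕜 F) : WeakDual 𝕜 E :=
  StrongDual.toWeakDual ((WeakDual.toStrongDual f).comp A)

@[simp]
theorem adj_apply (A : E →L[𝕜] F) (f : WeakDual 𝕜 F) (x : E) : adj A f x = f (A x) := rfl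

theorem continuous_adj (A : E →L[𝕜] F) : Continuous (adj A) :=
  WeakDual.continuous_of_continuous_eval fun x => WeakDual.eval_continuous (A x)

theorem adj_sub (A : E →L[𝕜] F) (f g : WeakDual 𝕜 F) : adj A (f - g) = adj A f - adj A g := rfl

theorem wnorm_nonneg (f : WeakDual 𝕜 E) : 0 ≤ wnorm f := norm_nonneg _

theorem norm_apply_le (f : WeakDual 𝕜 E) (x : E) : ‖f x‖ ≤ wnorm f * ‖x‖ :=
  (WeakDual.toStrongDual f).le_opNorm x

theorem wnorm_le {f : WeakDual 𝕜 E} {M : ℝ} (hM : 0 ≤ M) (h : ∀ x, ‖f x‖ ≤ M * ‖x‖) :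
    wnorm f ≤ M :=
  ContinuousLinearMap.opNorm_le_bound _ hM h

theorem wnorm_zero : wnorm (0 : WeakDual 𝕜 E) = 0 := norm_zero (E := StrongDual 𝕜 E)

theorem wnorm_sub_le (f g : WeakDual 𝕜 E) : wnorm (f - g) ≤ wnorm f + wnorm g :=
  norm_sub_le (E := StrongDual 𝕜 E) _ _

theorem wnorm_smul (c : 𝕜) (f : WeakDual 𝕜 E) : wnorm (c • f) = ‖c‖ * wnorm f := by
  rw [wnorm, map_smul, norm_smul, wnorm]

theorem wnorm_adj_le (A : E →L[𝕜] F) (f : WeakDual 𝕜 F) : wnorm (adj A f) ≤ wnorm f * ‖A‖ :=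
  ContinuousLinearMap.opNorm_comp_le (WeakDual.toStrongDual f) A

theorem wnorm_adj_le_of_le_one {A : E →L[𝕜] F} (hA : ‖A‖ ≤ 1) (f : WeakDual 𝕜 F) :
    wnorm (adj A f) ≤ wnorm f :=
  (wnorm_adj_le A f).trans (mul_le_of_le_one_right (wnorm_nonneg f) hA)

theorem isOpen_lt_wnorm (r : ℝ) : IsOpen {f : WeakDual 𝕜 E | r < wnorm f} := by
  have := (WeakDual.isClosed_closedBall (0 : StrongDual 𝕜 E) r).isOpen_compl
  convert this using 1
  ext f
  simp [wnorm]

theorem iterDerivative_eq {ε : ℝ} (hε : 0 ≤ ε) (K : Set (StrongDual 𝕜 E)) (β : Ordinal.{u}) :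
    iterDerivative ε K β =
      StrongDual.toWeakDual ⁻¹' iterDerive (far ε) (WeakDual.toStrongDual ⁻¹' K) β := by
  induction β using Ordinal.limitRecOn with
  | zero => rw [iterDerivative_zero, iterDerive_zero]; rfl
  | add_one β ih =>
    rw [← Order.succ_eq_add_one, iterDerivative_succ, iterDerive_succ, ih]
    ext f
    refine and_congr Iff.rfl (forall_congr' fun V => forall_congr' fun _ => forall_congr' fun _ => ?_)
    rw [Metric.ediam]
    simp only [lt_iSup_iff]
    constructor
    · rintro ⟨g, hg, h, hh, hlt⟩
      refine ⟨StrongDual.toWeakDual g, hg, StrongDual.toWeakDual h, hh, ?_⟩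
      rw [edist_dist, ENNReal.ofReal_lt_ofReal_iff_of_nonneg hε, dist_eq_norm] at hlt
      exact hlt
    · rintro ⟨g, hg, h, hh, hlt⟩
      refine ⟨WeakDual.toStrongDual g, hg, WeakDual.toStrongDual h, hh, ?_⟩
      rw [edist_dist, ENNReal.ofReal_lt_ofReal_iff_of_nonneg hε, dist_eq_norm]
      exact hlt
  | limit β hβ ih =>
    rw [iterDerivative_limit _ _ hβ, iterDerive_limit _ _ hβ]
    simp only [preimage_iInter]
    exact iInter₂_congr ih

theorem iterDerivative_closedBall {ε : ℝ} (hε : 0 ≤ ε) (β : Ordinal.{u}) :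
    iterDerivative ε (Metric.closedBall (0 : StrongDual 𝕜 E) 1) β =
      StrongDual.toWeakDual ⁻¹' szlenkSet 𝕜 E ε 1 β := by
  rw [iterDerivative_eq hε, szlenkSet]
  congr 2
  ext f
  simp [wnorm]

/-- For `ε < 1` a larger exponent weakens the estimate, so natural exponents suffice; in the
converse, `N + 1` secures `1 ≤ p`. -/
theorem pzl₀_iff [CompleteSpace E] {α : Ordinal.{u}} :
    Pzl₀ 𝕜 α E ↔ ∃ c ∈ Ioo (0 : ℝ) 1, ∃ N : ℕ, ∀ ε ∈ Ioo (0 : ℝ) 1,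
      ∀ f ∈ szlenkSet 𝕜 E ε 1 (Ordinal.omega0 ^ α), wnorm f ≤ 1 - c * ε ^ N := by
  constructor
  · rintro ⟨c, hc, p, hp, h⟩
    refine ⟨c, hc, ⌈p⌉₊, fun ε hε f hf => ?_⟩
    have := h ε hε
    rw [iterDerivative_closedBall hε.1.le] at this
    have h1 := this (a := WeakDual.toStrongDual f) hf
    rw [mem_closedBall_zero_iff] at h1
    refine h1.trans ?_
    have h2 : ε ^ (⌈p⌉₊ : ℝ) ≤ ε ^ p :=
      Real.rpow_le_rpow_of_exponent_ge hε.1 hε.2.le (Nat.le_ceil p)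
    rw [Real.rpow_natCast] at h2
    have := mul_le_mul_of_nonneg_left h2 hc.1.le
    linarith
  · rintro ⟨c, hc, N, h⟩
    refine ⟨c, hc, (N + 1 : ℕ), by simp, fun ε hε f hf => ?_⟩
    rw [iterDerivative_closedBall hε.1.le] at hf
    rw [mem_closedBall_zero_iff]
    refine (h ε hε _ hf).trans ?_
    rw [Real.rpow_natCast]
    have := mul_le_mul_of_nonneg_left
      (pow_le_pow_of_le_one hε.1.le hε.2.le (Nat.le_add_right N 1)) hc.1.le
    linarith

/-- Already the first derivative is nonempty, so the ball contains two `ε`-far points. -/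
theorem half_le_of_mem_szlenkSet {ε ρ : ℝ} {α : Ordinal.{u}} {f : WeakDual 𝕜 E}
    (hf : f ∈ szlenkSet 𝕜 E ε ρ (Ordinal.omega0 ^ α)) : ε / 2 ≤ ρ := by
  have h1 : (1 : Ordinal.{u}) ≤ Ordinal.omega0 ^ α :=
    Order.one_le_iff_pos.2 (Ordinal.opow_pos _ Ordinal.omega0_pos)
  have := iterDerive_antitone _ _ h1 hf
  rw [iterDerive_one] at this
  obtain ⟨g, hg, h, hh, hlt⟩ := this.2 univ isOpen_univ trivial
  have h2 := wnorm_sub_le g h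
  have h3 : ε < wnorm (g - h) := hlt
  have h4 : wnorm g ≤ ρ := hg.1
  have h5 : wnorm h ≤ ρ := hh.1
  linarith

theorem continuous_smul_weakDual (c : 𝕜) : Continuous fun f : WeakDual 𝕜 E => c • f :=
  continuous_const_smul c

/-- The dual ball of radius `ρ` shrinks proportionally. -/
theorem wnorm_le_of_mem_szlenkSet {ε ρ r : ℝ} (hε : 0 < ε) (hρ : ρ ≤ 1) {α : Ordinal.{u}}
    (h : ∀ f ∈ szlenkSet 𝕜 E ε 1 (Ordinal.omega0 ^ α), wnorm f ≤ r)
    {f : WeakDual 𝕜 E} (hf : f ∈ szlenkSet 𝕜 E ε ρ (Ordinal.omega0 ^ α)) :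
    wnorm f ≤ ρ * r := by
  have hρ0 : 0 < ρ := (half_pos hε).trans_le (half_le_of_mem_szlenkSet hf)
  have hn : ∀ g : WeakDual 𝕜 E, wnorm (((ρ⁻¹ : ℝ) : 𝕜) • g) = ρ⁻¹ * wnorm g := fun g => by
    rw [wnorm_smul, RCLike.norm_ofReal, abs_of_pos (inv_pos.2 hρ0)]
  have := mapsTo_iterDerive_univ (r := far ε) (s := far ε) (K := {f : WeakDual 𝕜 E | wnorm f ≤ ρ})
    (L := {f | wnorm f ≤ 1})
    (continuous_smul_weakDual (((ρ⁻¹ : ℝ) : 𝕜))) (fun g hg => ?_) (fun g _ k _ hgk => ?_)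
    (Ordinal.omega0 ^ α) hf
  · have := h _ this
    rw [hn] at this
    rwa [inv_mul_le_iff₀ hρ0] at this
  · change wnorm _ ≤ 1
    rw [hn, inv_mul_le_iff₀ hρ0, mul_one]
    exact hg
  · change ε < wnorm _
    rw [← smul_sub, hn]
    have h1 : ε < wnorm (g - k) := hgk
    have h2 : 1 ≤ ρ⁻¹ := (one_le_inv₀ hρ0).2 hρ
    -- As `ρ ≤ 1`, blowing up to the unit ball does not decrease distances, so `ε` may be kept.
    nlinarith [wnorm_nonneg (g - k)]

/-- Unimodular factors on `x` and `y` make `f (A x)` and `f (B y)` nonnegative reals, which then add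
without cancellation. -/
theorem wnorm_adj_add_wnorm_adj_le {D : Type u} [NormedAddCommGroup D] [NormedSpace 𝕜 D]
    {A : D →L[𝕜] E} {B : F →L[𝕜] E} {C : ℝ}
    (hC : ∀ x y, ‖x‖ ≤ 1 → ‖y‖ ≤ 1 → ‖A x + B y‖ ≤ C) (f : WeakDual 𝕜 E) :
    wnorm (adj A f) + wnorm (adj B f) ≤ C * wnorm f := by
  have key : ∀ x y, ‖x‖ ≤ 1 → ‖y‖ ≤ 1 → ‖f (A x)‖ + ‖f (B y)‖ ≤ C * wnorm f := by
    intro x y hx hy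
    obtain ⟨a, ha, ha'⟩ := RCLike.exists_norm_eq_mul_self (f (A x))
    obtain ⟨b, hb, hb'⟩ := RCLike.exists_norm_eq_mul_self (f (B y))
    have h1 := hC (a • x) (b • y) (by rw [norm_smul, ha, one_mul]; exact hx)
      (by rw [norm_smul, hb, one_mul]; exact hy)
    have h2 : f (A (a • x) + B (b • y)) = ((‖f (A x)‖ + ‖f (B y)‖ : ℝ) : 𝕜) := by
      rw [map_add, map_smul, map_smul, map_smul, map_smul, RCLike.ofReal_add, ha', hb']
      rfl
    have h3 := norm_apply_le f (A (a • x) + B (b • y))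
    rw [h2, RCLike.norm_ofReal, abs_of_nonneg (by positivity)] at h3
    refine h3.trans ?_
    rw [mul_comm]
    exact mul_le_mul_of_nonneg_right h1 (wnorm_nonneg f)
  have h1 : ∀ y, ‖y‖ ≤ 1 → wnorm (adj A f) ≤ C * wnorm f - ‖f (B y)‖ := by
    intro y hy
    refine ContinuousLinearMap.opNorm_le_of_unit_norm ?_ fun x hx => ?_
    · have := key 0 y (by simp) hy
      simp only [map_zero, norm_zero, zero_add] at this
      linarith
    · have := key x y hx.le hy
      change ‖f (A x)‖ ≤ _
      linarith
  have h2 : wnorm (adj B f) ≤ C * wnorm f - wnorm (adj A f) := by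
    refine ContinuousLinearMap.opNorm_le_of_unit_norm ?_ fun y hy => ?_
    · have := h1 0 (by simp)
      simp only [map_zero, norm_zero, sub_zero] at this
      linarith
    · have := h1 y hy.le
      change ‖f (B y)‖ ≤ _
      linarith
  linarith

end WeakStar

/-! ### Finite products and the operator ideal -/

section Products

variable {𝕜 : Type} [RCLike 𝕜] {D : Type u} [NormedAddCommGroup D] [NormedSpace 𝕜 D]
  {E : Type u} [NormedAddCommGroup E] [NormedSpace 𝕜 E]

theorem wnorm_le_add_adj_prod (f : WeakDual 𝕜 (D × E)) :
    wnorm f ≤ wnorm (adj (ContinuousLinearMap.inl 𝕜 D E) f) +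
      wnorm (adj (ContinuousLinearMap.inr 𝕜 D E) f) := by
  refine wnorm_le (add_nonneg (wnorm_nonneg _) (wnorm_nonneg _)) fun x => ?_
  have h1 : f x = adj (ContinuousLinearMap.inl 𝕜 D E) f x.1 +
      adj (ContinuousLinearMap.inr 𝕜 D E) f x.2 := by
    simp only [adj_apply]
    rw [← map_add]
    simp
  rw [h1, add_mul]
  refine (norm_add_le _ _).trans (add_le_add ?_ ?_)
  · exact (norm_apply_le _ _).trans (mul_le_mul_of_nonneg_left (norm_fst_le x) (wnorm_nonneg _))
  · exact (norm_apply_le _ _).trans (mul_le_mul_of_nonneg_left (norm_snd_le x) (wnorm_nonneg _))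

theorem wnorm_adj_add_wnorm_adj_prod_le (f : WeakDual 𝕜 (D × E)) :
    wnorm (adj (ContinuousLinearMap.inl 𝕜 D E) f) +
      wnorm (adj (ContinuousLinearMap.inr 𝕜 D E) f) ≤ wnorm f := by
  have := wnorm_adj_add_wnorm_adj_le (A := ContinuousLinearMap.inl 𝕜 D E)
    (B := ContinuousLinearMap.inr 𝕜 D E) (C := 1)
    (fun x y hx hy => by simp [Prod.norm_def, hx, hy]) f
  linarith

/-- The estimate for one of the two summands of a space, in terms of an operator `A` onto which
the derivation is projected and an operator `B` measuring the remainder. -/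
theorem wnorm_adj_add_le_of_mem {X : Type u} [NormedAddCommGroup X] [NormedSpace 𝕜 X]
    {A : D →L[𝕜] X} {B : E →L[𝕜] X} (hAB : ∀ f, wnorm (adj A f) + wnorm (adj B f) ≤ wnorm f)
    {α : Ordinal.{u}} {c ε : ℝ} {N : ℕ} (hc : c ∈ Ioo (0 : ℝ) 1) (hε : ε ∈ Ioo (0 : ℝ) 1)
    (h : ∀ f ∈ szlenkSet 𝕜 D ε 1 (Ordinal.omega0 ^ α), wnorm f ≤ 1 - c * ε ^ N)
    {f : WeakDual 𝕜 X} (hf : f ∈ iterDerive (fun g k => far ε (adj A g) (adj A k))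
      {f | wnorm f ≤ 1} (Ordinal.omega0 ^ α)) :
    wnorm (adj A f) + wnorm (adj B f) ≤ 1 - (ε / 2) * (c * ε ^ N) := by
  have hq : 0 < c * ε ^ N := mul_pos hc.1 (pow_pos hε.1 N)
  have hlt : ∀ b < wnorm (adj B f), b ≤ 1 - (ε / 2) * (c * ε ^ N) - wnorm (adj A f) := by
    intro b hb
    have hU : IsOpen {g : WeakDual 𝕜 X | b < wnorm (adj B g)} :=
      (isOpen_lt_wnorm b).preimage (continuous_adj B)
    -- Where the `B`-part exceeds `b`, the `A`-part has norm at most `1 - b`, so the derivation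
    -- projects to one of a smaller ball. Survival forces its radius to be at least `ε / 2`, whence
    -- the factor `ε / 2` in the gain.
    have hmem : adj A f ∈ szlenkSet 𝕜 D ε (min 1 (1 - b)) (Ordinal.omega0 ^ α) := by
      refine mapsTo_iterDerive (U := {g : WeakDual 𝕜 X | b < wnorm (adj B g)})
        (continuous_adj A) hU ?_ (fun _ _ _ _ => id) (Ordinal.omega0 ^ α) ⟨hf, hb⟩
      rintro g ⟨hg, hgb⟩
      have h1 := hAB g
      have h2 : wnorm g ≤ 1 := hg
      have h3 : b < wnorm (adj B g) := hgb
      have h4 := wnorm_nonneg (adj B g)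
      have h5 := wnorm_nonneg (adj A g)
      change wnorm (adj A g) ≤ _
      exact le_min (by linarith) (by linarith)
    have h1 := half_le_of_mem_szlenkSet hmem
    have h2 := wnorm_le_of_mem_szlenkSet hε.1 (min_le_left _ _) h hmem
    have h3 := mul_le_mul_of_nonneg_right h1 hq.le
    have h4 := min_le_right 1 (1 - b)
    linarith
  have := le_of_forall_lt_imp_le_of_dense hlt
  linarith

variable [CompleteSpace D] [CompleteSpace E]

theorem Pzl₀.prod {α : Ordinal.{u}} (hD : Pzl₀ 𝕜 α D) (hE : Pzl₀ 𝕜 α E) : Pzl₀ 𝕜 α (D × E) := by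
  rw [pzl₀_iff] at *
  obtain ⟨c₁, hc₁, N₁, h₁⟩ := hD
  obtain ⟨c₂, hc₂, N₂, h₂⟩ := hE
  refine ⟨min c₁ c₂ / 4 * (1 / 2) ^ (max N₁ N₂), ⟨?_, ?_⟩, max N₁ N₂ + 1, fun ε hε f hf => ?_⟩
  · have := lt_min hc₁.1 hc₂.1
    positivity
  · have h1 : ((1 : ℝ) / 2) ^ (max N₁ N₂) ≤ 1 := pow_le_one₀ (by norm_num) (by norm_num)
    have h2 : min c₁ c₂ < 1 := (min_le_left _ _).trans_lt hc₁.2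
    have h3 : 0 < min c₁ c₂ := lt_min hc₁.1 hc₂.1
    nlinarith
  have hε2 : ε / 2 ∈ Ioo (0 : ℝ) 1 := ⟨by linarith [hε.1], by linarith [hε.2]⟩
  have hor := iterDerive_or_subset (r := far ε)
    (r₁ := fun g k => far (ε / 2) (adj (ContinuousLinearMap.inl 𝕜 D E) g)
      (adj (ContinuousLinearMap.inl 𝕜 D E) k))
    (r₂ := fun g k => far (ε / 2) (adj (ContinuousLinearMap.inr 𝕜 D E) g)
      (adj (ContinuousLinearMap.inr 𝕜 D E) k)) (fun g k hgk => by
        by_contra hcon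
        simp only [far, ← adj_sub, not_or, not_lt] at hcon hgk
        have := wnorm_le_add_adj_prod (g - k)
        linarith) α _ hf
  have hbound : ∀ c N, min c₁ c₂ ≤ c → N ≤ max N₁ N₂ →
      min c₁ c₂ / 4 * (1 / 2) ^ (max N₁ N₂) * ε ^ (max N₁ N₂ + 1) ≤
        ε / 2 / 2 * (c * (ε / 2) ^ N) := by
    intro c N hc hN
    have h1 : (ε / 2) ^ (max N₁ N₂) ≤ (ε / 2) ^ N := pow_le_pow_of_le_one hε2.1.le hε2.2.le hN
    have h2 : min c₁ c₂ * (ε / 2) ^ (max N₁ N₂) ≤ c * (ε / 2) ^ N :=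
      mul_le_mul hc h1 (pow_nonneg hε2.1.le _) ((lt_min hc₁.1 hc₂.1).le.trans hc)
    have h3 := mul_le_mul_of_nonneg_left h2 (a := ε / 4) (by linarith [hε.1])
    calc _ = ε / 4 * (min c₁ c₂ * (ε / 2) ^ (max N₁ N₂)) := by
          rw [div_pow, div_pow]; ring
      _ ≤ _ := h3
      _ = _ := by ring
  refine (wnorm_le_add_adj_prod f).trans ?_
  rcases hor with h | h
  · have h1 := wnorm_adj_add_le_of_mem (B := ContinuousLinearMap.inr 𝕜 D E)
      wnorm_adj_add_wnorm_adj_prod_le hc₁ hε2 (h₁ _ hε2) h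
    have h2 := hbound c₁ N₁ (min_le_left _ _) (le_max_left _ _)
    linarith
  · have h1 := wnorm_adj_add_le_of_mem (B := ContinuousLinearMap.inl 𝕜 D E)
      (fun f => by rw [add_comm]; exact wnorm_adj_add_wnorm_adj_prod_le f) hc₂ hε2 (h₂ _ hε2) h
    have h2 := hbound c₂ N₂ (min_le_right _ _) (le_max_right _ _)
    linarith

theorem Pzl.prod {α : Ordinal.{u}} (hD : Pzl 𝕜 α D) (hE : Pzl 𝕜 α E) : Pzl 𝕜 α (D × E) := by
  obtain ⟨D', _, _, _, hD', ⟨e⟩⟩ := hD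
  obtain ⟨E', _, _, _, hE', ⟨e'⟩⟩ := hE
  exact ⟨D' × E', inferInstance, inferInstance, inferInstance, hD'.prod hE', ⟨e.prodCongr e'⟩⟩

theorem Pzl.of_equiv {α : Ordinal.{u}} (hD : Pzl 𝕜 α D) (e : E ≃L[𝕜] D) : Pzl 𝕜 α E := by
  obtain ⟨D', _, _, _, hD', ⟨e'⟩⟩ := hD
  exact ⟨D', _, _, _, hD', ⟨e.trans e'⟩⟩

theorem Pzl₀.pzl {α : Ordinal.{u}} (hD : Pzl₀ 𝕜 α D) : Pzl 𝕜 α D :=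
  ⟨D, _, _, _, hD, ⟨ContinuousLinearEquiv.refl 𝕜 D⟩⟩

variable (𝕜) in
theorem szlenkSet_ulift_eq_empty {ε : ℝ} (hε : 0 < ε) (α : Ordinal.{u}) :
    szlenkSet 𝕜 (ULift.{u} 𝕜) ε 1 (Ordinal.omega0 ^ α) = ∅ := by
  refine eq_empty_of_forall_notMem fun f hf => ?_
  have h1 : (1 : Ordinal.{u}) ≤ Ordinal.omega0 ^ α :=
    Order.one_le_iff_pos.2 (Ordinal.opow_pos _ Ordinal.omega0_pos)
  have := iterDerive_antitone _ _ h1 hf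
  rw [iterDerive_one] at this
  obtain ⟨g, ⟨-, hg⟩, k, ⟨-, hk⟩, hlt⟩ := this.2 {g | ‖g (ULift.up 1) - f (ULift.up 1)‖ < ε / 2}
    (isOpen_lt (((WeakDual.eval_continuous _).sub continuous_const).norm) continuous_const)
    (by simp [hε])
  have h2 : wnorm (g - k) ≤ ‖g (ULift.up 1) - k (ULift.up 1)‖ := by
    refine wnorm_le (norm_nonneg _) fun x => ?_
    have : (g - k) x = x.down * (g (ULift.up 1) - k (ULift.up 1)) := by
      have hx : x = x.down • (ULift.up 1 : ULift.{u} 𝕜) := by ext; simp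
      rw [hx, map_smul]
      simp only [← hx]
      rfl
    rw [this, norm_mul, mul_comm]
    rfl
  have h3 : ε < wnorm (g - k) := hlt
  have h4 : ‖g (ULift.up 1) - f (ULift.up 1)‖ < ε / 2 := hg
  have h5 : ‖k (ULift.up 1) - f (ULift.up 1)‖ < ε / 2 := hk
  have h6 := norm_sub_le (g (ULift.up 1) - f (ULift.up 1)) (k (ULift.up 1) - f (ULift.up 1))
  rw [sub_sub_sub_cancel_right] at h6
  linarith

variable (𝕜) in
theorem pzl_ulift (α : Ordinal.{u}) : Pzl 𝕜 α (ULift.{u} 𝕜) := by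
  refine Pzl₀.pzl (pzl₀_iff.2 ⟨1 / 2, by norm_num, 0, fun ε hε f hf => ?_⟩)
  rw [szlenkSet_ulift_eq_empty 𝕜 hε.1] at hf
  exact hf.elim

variable (𝕜) in
theorem isOperatorIdeal_op_pzl (α : Ordinal.{u}) : IsOperatorIdeal (Op (Pzl 𝕜 α)) where
  id_mem := ⟨ULift.{u} 𝕜, _, _, inferInstance, ContinuousLinearMap.id _ _,
    ContinuousLinearMap.id _ _, pzl_ulift 𝕜 α, rfl⟩
  add_mem := by
    rintro E F _ _ _ _ _ _ S T ⟨D₁, _, _, _, A₁, B₁, h₁, rfl⟩ ⟨D₂, _, _, _, A₂, B₂, h₂, rfl⟩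
    refine ⟨D₁ × D₂, inferInstance, inferInstance, inferInstance, A₁.prod A₂, B₁.coprod B₂,
      h₁.prod h₂, ?_⟩
    ext x
    simp
  comp_mem := by
    rintro D E F G _ _ _ _ _ _ _ _ _ _ _ _ U T V ⟨D₁, _, _, _, A, B, h, rfl⟩
    exact ⟨D₁, _, _, _, A.comp U, V.comp B, h, rfl⟩

end Products

end Szlenk

namespace Szlenk

/-! ### Polynomial bounds on the number of blocks -/

section Iteration

variable {𝕜 : Type} [RCLike 𝕜] {D : Type u} [NormedAddCommGroup D] [NormedSpace 𝕜 D]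

theorem szlenkSet_mul_succ (ε : ℝ) (o : Ordinal.{u}) (k : ℕ) :
    szlenkSet 𝕜 D ε 1 (o * (k + 1 : ℕ)) = iterDerive (far ε) (szlenkSet 𝕜 D ε 1 (o * k)) o := by
  rw [szlenkSet, Nat.cast_succ, mul_add_one, iterDerive_add, szlenkSet]

theorem wnorm_le_pow_of_mem_szlenkSet {α : Ordinal.{u}} {ε q : ℝ} (hε : 0 < ε) (hq : q ∈ Icc (0 : ℝ) 1)
    (h : ∀ f ∈ szlenkSet 𝕜 D ε 1 (Ordinal.omega0 ^ α), wnorm f ≤ q) (k : ℕ) :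
    ∀ f ∈ szlenkSet 𝕜 D ε 1 (Ordinal.omega0 ^ α * k), wnorm f ≤ q ^ k := by
  induction k with
  | zero =>
    intro f hf
    simpa [szlenkSet, iterDerive_zero] using hf
  | succ k ih =>
    intro f hf
    rw [szlenkSet_mul_succ] at hf
    rw [pow_succ]
    exact wnorm_le_of_mem_szlenkSet hε (pow_le_one₀ hq.1 hq.2) h (iterDerive_mono ih _ hf)

/-- For a space in `Pzl₀`, the number of blocks of `ω ^ α` derivations which exhaust the dual ball
is polynomial in `1 / ε`. -/
theorem Pzl₀.exists_szlenkSet_eq_empty [CompleteSpace D] {α : Ordinal.{u}} (hD : Pzl₀ 𝕜 α D) :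
    ∃ (M : ℝ) (N : ℕ), ∀ ε ∈ Ioo (0 : ℝ) 1, ∀ k : ℕ, M ≤ k * ε ^ N →
      szlenkSet 𝕜 D ε 1 (Ordinal.omega0 ^ α * k) = ∅ := by
  obtain ⟨c, hc, N, h⟩ := pzl₀_iff.1 hD
  refine ⟨2 / c + 2, N + 1, fun ε hε k hk => eq_empty_of_forall_notMem fun f hf => ?_⟩
  have hx0 : 0 < c * ε ^ N := mul_pos hc.1 (pow_pos hε.1 N)
  have hx1 : c * ε ^ N < 1 := by
    have := pow_le_one₀ hε.1.le hε.2.le (n := N)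
    nlinarith [hc.1, hc.2]
  have hk' : 2 / c < k * ε ^ (N + 1) := by linarith
  rcases k with _ | k
  · have := div_pos two_pos hc.1
    simp only [Nat.cast_zero, zero_mul] at hk'
    linarith
  rw [szlenkSet_mul_succ] at hf
  have h1 := half_le_of_mem_szlenkSet (iterDerive_mono (wnorm_le_pow_of_mem_szlenkSet hε.1
    (q := 1 - c * ε ^ N) ⟨by linarith, by linarith⟩ (h ε hε) k) _ hf)
  -- With `x = c * ε ^ N`, Bernoulli's inequality and `(1 - x) (1 + x) ≤ 1` give `(1 - x) ^ k ≤ 1 /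
  -- (1 + k x)`, while the ball before the last block has radius at least `ε / 2`.
  have h2 := one_add_mul_le_pow (a := c * ε ^ N) (by linarith) k
  have h3 : (1 - c * ε ^ N) ^ k * (1 + c * ε ^ N) ^ k ≤ 1 := by
    rw [← mul_pow]
    exact pow_le_one₀ (by nlinarith) (by nlinarith)
  have h4 : ε / 2 * (1 + k * (c * ε ^ N)) ≤ 1 :=
    (mul_le_mul h1 h2 (by positivity) (pow_nonneg (by linarith) k)).trans h3
  have h5 : (k : ℝ) * ε ^ (N + 1) ≤ 2 / c := by
    rw [le_div_iff₀ hc.1, pow_succ]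
    nlinarith [hε.1]
  have h6 : ε ^ (N + 1) ≤ 1 := pow_le_one₀ hε.1.le hε.2.le
  push_cast at hk
  linarith

/-- If a multiple `s` of the identity of `F` factors through a space in `Pzl`, then the number of
blocks of `ω ^ α` derivations which exhaust the dual ball of `F` is polynomial in `1 / s`. -/
theorem Pzl.exists_szlenkSet_eq_empty [CompleteSpace D] {α : Ordinal.{u}} (hD : Pzl 𝕜 α D)
    (C : ℝ) {ε : ℝ} (hε : 0 < ε) :
    ∃ (M : ℝ) (N : ℕ), ∀ (F : Type u) [NormedAddCommGroup F] [NormedSpace 𝕜 F] (A : F →L[𝕜] D)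
      (B : D →L[𝕜] F) (s : ℝ), 0 < s → s ≤ 1 → ‖A‖ ≤ C → ‖B‖ ≤ C →
      (∀ x, B (A x) = (s : 𝕜) • x) → ∀ k : ℕ, M ≤ k * s ^ N →
      szlenkSet 𝕜 F ε 1 (Ordinal.omega0 ^ α * k) = ∅ := by
  obtain ⟨D', _, _, _, hD', ⟨e⟩⟩ := hD
  obtain ⟨M, N, h⟩ := hD'.exists_szlenkSet_eq_empty
  set e₁ : D →L[𝕜] D' := e.toContinuousLinearMap
  set e₂ : D' →L[𝕜] D := e.symm.toContinuousLinearMap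
  set C' : ℝ := |C| * (‖e₁‖ + ‖e₂‖) + 1 with hC'
  have hC'1 : 1 ≤ C' := by
    have : 0 ≤ |C| * (‖e₁‖ + ‖e₂‖) := by positivity
    linarith
  have hC'0 : 0 < C' := one_pos.trans_le hC'1
  -- The map `C'⁻¹ • (B e₂)*` sends the dual ball of `F` into that of `D'`, and `ε`-far pairs to
  -- pairs more than `s ε / C' ^ 2` apart; `t` lies below `1` and at most at `ε / C' ^ 2`.
  set t : ℝ := ε / (C' ^ 2 * (1 + ε)) with ht
  have ht0 : 0 < t := by positivity
  have ht1 : t < 1 := by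
    rw [ht, div_lt_one (by positivity)]
    nlinarith [one_le_pow₀ hC'1 (n := 2)]
  have htC : t * C' ^ 2 ≤ ε := by
    rw [ht, div_mul_eq_mul_div, div_le_iff₀ (by positivity)]
    have : 0 < C' ^ 2 := by positivity
    nlinarith [mul_pos hε this, mul_pos hε (mul_pos hε this)]
  refine ⟨M / t ^ N, N, fun F _ _ A B s hs0 hs1 hA hB hBA k hk =>
    eq_empty_of_forall_notMem fun f hf => ?_⟩
  have hCC : C ≤ |C| := le_abs_self C
  have hA' : ‖e₁.comp A‖ ≤ C' := by
    refine (ContinuousLinearMap.opNorm_comp_le _ _).trans ?_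
    have := mul_le_mul_of_nonneg_left (hA.trans hCC) (norm_nonneg e₁)
    nlinarith [mul_nonneg (abs_nonneg C) (norm_nonneg e₂)]
  have hB' : ‖B.comp e₂‖ ≤ C' := by
    refine (ContinuousLinearMap.opNorm_comp_le _ _).trans ?_
    have := mul_le_mul_of_nonneg_right (hB.trans hCC) (norm_nonneg e₂)
    nlinarith [mul_nonneg (abs_nonneg C) (norm_nonneg e₁)]
  have hadj : ∀ g : WeakDual 𝕜 F, adj (e₁.comp A) (adj (B.comp e₂) g) = (s : 𝕜) • g := by
    intro g
    refine DFunLike.ext _ _ fun x => ?_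
    have : (B.comp e₂) ((e₁.comp A) x) = (s : 𝕜) • x := by
      simp [e₁, e₂, hBA]
    rw [adj_apply, adj_apply, this, map_smul]
    rfl
  have hlow : ∀ g : WeakDual 𝕜 F, s * wnorm g ≤ wnorm (adj (B.comp e₂) g) * C' := by
    intro g
    have h1 := wnorm_adj_le (e₁.comp A) (adj (B.comp e₂) g)
    rw [hadj, wnorm_smul, RCLike.norm_ofReal, abs_of_pos hs0] at h1
    exact h1.trans (mul_le_mul_of_nonneg_left hA' (wnorm_nonneg _))
  have hn : ∀ g : WeakDual 𝕜 D', wnorm (((C'⁻¹ : ℝ) : 𝕜) • g) = C'⁻¹ * wnorm g := fun g => by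
    rw [wnorm_smul, RCLike.norm_ofReal, abs_of_pos (inv_pos.2 hC'0)]
  have hmem : ((C'⁻¹ : ℝ) : 𝕜) • adj (B.comp e₂) f ∈
      szlenkSet 𝕜 D' (s * t) 1 (Ordinal.omega0 ^ α * k) := by
    refine mapsTo_iterDerive_univ (f := fun g => ((C'⁻¹ : ℝ) : 𝕜) • adj (B.comp e₂) g)
      ((continuous_smul_weakDual _).comp (continuous_adj _)) (fun g hg => ?_)
      (fun g _ l _ hgl => ?_) _ hf
    · have hg1 : wnorm g ≤ 1 := hg
      change wnorm _ ≤ 1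
      rw [hn, inv_mul_le_iff₀ hC'0, mul_one]
      refine (wnorm_adj_le _ _).trans ?_
      nlinarith [norm_nonneg (B.comp e₂), wnorm_nonneg g]
    · have hgl' : ε < wnorm (g - l) := hgl
      change s * t < wnorm _
      rw [← smul_sub, ← adj_sub, hn, lt_inv_mul_iff₀ hC'0]
      have h1 := hlow (g - l)
      have h2 : s * (t * C' ^ 2) ≤ s * ε := mul_le_mul_of_nonneg_left htC hs0.le
      have h3 : s * ε < s * wnorm (g - l) := mul_lt_mul_of_pos_left hgl' hs0
      have h4 : C' * (s * t) * C' < wnorm (adj (B.comp e₂) (g - l)) * C' := by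
        nlinarith
      exact lt_of_mul_lt_mul_right h4 hC'0.le
  rw [h (s * t) ⟨by positivity, by nlinarith⟩ k ?_] at hmem
  · exact hmem.elim
  · rw [div_le_iff₀ (by positivity)] at hk
    rw [mul_pow]
    linarith

/-- Factoring the identity through `D` itself, finitely many blocks `ω ^ γ` suffice, and `ω ^ γ * n
< ω ^ α`. -/
theorem Pzl.szlenkSet_eq_empty [CompleteSpace D] {γ α : Ordinal.{u}} (hD : Pzl 𝕜 γ D)
    (hγ : γ < α) {ε : ℝ} (hε : 0 < ε) : szlenkSet 𝕜 D ε 1 (Ordinal.omega0 ^ α) = ∅ := by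
  obtain ⟨M, N, h⟩ := hD.exists_szlenkSet_eq_empty 1 hε
  have h1 := h D (ContinuousLinearMap.id 𝕜 D) (ContinuousLinearMap.id 𝕜 D) 1 one_pos le_rfl
    ContinuousLinearMap.norm_id_le ContinuousLinearMap.norm_id_le (fun x => by simp) ⌈M⌉₊
    (by simpa using Nat.le_ceil M)
  refine subset_empty_iff.1 (h1 ▸ iterDerive_antitone _ _ ?_)
  exact (Ordinal.opow_mul_lt_opow (Ordinal.natCast_lt_omega0 _) hγ).le

end Iteration

/-! ### Dual balls that survive many derivations -/

section LowerBounds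

variable {𝕜 : Type} [RCLike 𝕜] {E : Type u} [NormedAddCommGroup E] [NormedSpace 𝕜 E]
  {F : Type u} [NormedAddCommGroup F] [NormedSpace 𝕜 F]
  {X : Type u} [NormedAddCommGroup X] [NormedSpace 𝕜 X]

theorem adj_zero (A : E →L[𝕜] F) : adj A 0 = 0 := rfl

theorem wnorm_le_wnorm_adj {P : X →L[𝕜] F} {J : F →L[𝕜] X} (hJ : ‖J‖ ≤ 1) (hPJ : ∀ x, P (J x) = x)
    (f : WeakDual 𝕜 F) : wnorm f ≤ wnorm (adj P f) := by
  have h : adj J (adj P f) = f := by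
    refine DFunLike.ext _ _ fun x => ?_
    simp [hPJ]
  conv_lhs => rw [← h]
  exact wnorm_adj_le_of_le_one hJ _

theorem zero_mem_szlenkSet_of_retract {P : X →L[𝕜] F} {J : F →L[𝕜] X} (hP : ‖P‖ ≤ 1)
    (hJ : ‖J‖ ≤ 1) (hPJ : ∀ x, P (J x) = x) {ε : ℝ} {β : Ordinal.{u}}
    (h : 0 ∈ szlenkSet 𝕜 F ε 1 β) : 0 ∈ szlenkSet 𝕜 X ε 1 β := by
  refine adj_zero P ▸ mapsTo_iterDerive_univ (continuous_adj P) (fun g hg => ?_)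
    (fun g _ k _ hgk => ?_) β h
  · exact (wnorm_adj_le_of_le_one hP g).trans hg
  · change ε < wnorm _
    rw [← adj_sub]
    exact lt_of_lt_of_le hgk (wnorm_le_wnorm_adj hJ hPJ _)

/-- Derivations of the two factors of an `ℓ¹`-sum can be carried out one after the other. -/
theorem zero_mem_szlenkSet_withLp {ε : ℝ} {β γ : Ordinal.{u}} (hE : 0 ∈ szlenkSet 𝕜 E ε 1 β)
    (hF : 0 ∈ szlenkSet 𝕜 F ε 1 γ) : 0 ∈ szlenkSet 𝕜 (WithLp 1 (E × F)) ε 1 (γ + β) := by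
  set P : WithLp 1 (E × F) →L[𝕜] E := WithLp.fstL 1 𝕜 E F
  set Q : WithLp 1 (E × F) →L[𝕜] F := WithLp.sndL 1 𝕜 E F
  have hball : ∀ f g, wnorm f ≤ 1 → wnorm g ≤ 1 → wnorm (adj P f + adj Q g) ≤ 1 := by
    intro f g hf hg
    refine wnorm_le zero_le_one fun x => ?_
    have h1 : (adj P f + adj Q g) x = f x.fst + g x.snd := rfl
    rw [h1, WithLp.prod_norm_eq_of_L1, one_mul]
    refine (norm_add_le _ _).trans (add_le_add ?_ ?_)
    · exact (norm_apply_le f _).trans (mul_le_of_le_one_left (norm_nonneg _) hf)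
    · exact (norm_apply_le g _).trans (mul_le_of_le_one_left (norm_nonneg _) hg)
  have hPn : ∀ f : WeakDual 𝕜 E, wnorm f ≤ wnorm (adj P f) := fun f => by
    refine wnorm_le (wnorm_nonneg _) fun x => ?_
    have := norm_apply_le (adj P f) (WithLp.toLp 1 (x, 0))
    rw [WithLp.prod_norm_eq_of_L1] at this
    simpa [P] using this
  have hQn : ∀ f : WeakDual 𝕜 F, wnorm f ≤ wnorm (adj Q f) := fun f => by
    refine wnorm_le (wnorm_nonneg _) fun x => ?_
    have := norm_apply_le (adj Q f) (WithLp.toLp 1 (0, x))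
    rw [WithLp.prod_norm_eq_of_L1] at this
    simpa [Q] using this
  -- With the first coordinate frozen at `f`, `γ` derivations in the second leave `(f, 0)`; the copy
  -- of the ball of `E` so obtained then undergoes `β` more.
  have hγ : ∀ f, wnorm f ≤ 1 → adj P f ∈ szlenkSet 𝕜 (WithLp 1 (E × F)) ε 1 γ := by
    intro f hf
    have := mapsTo_iterDerive_univ (f := fun g => adj P f + adj Q g) (s := far ε)
      (L := {f | wnorm f ≤ 1}) (continuous_const.add (continuous_adj Q))
      (fun g hg => hball f g hf hg) (fun g _ k _ hgk => ?_) γ hF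
    · simpa [szlenkSet, adj_zero] using this
    · change ε < wnorm _
      rw [add_sub_add_left_eq_sub, ← adj_sub]
      exact lt_of_lt_of_le hgk (hQn _)
  rw [szlenkSet, iterDerive_add]
  refine adj_zero P ▸ mapsTo_iterDerive_univ (continuous_adj P) hγ (fun g _ k _ hgk => ?_) β hE
  change ε < wnorm _
  rw [← adj_sub]
  exact lt_of_lt_of_le hgk (hPn _)

/-- Use `k`-fold `ℓ¹`-sums: they are isomorphic to products, hence stay in `Pzl`, and their survival
times add up. -/
theorem exists_pzl_zero_mem_mul [CompleteSpace E] {α : Ordinal.{u}} {ε : ℝ} (hE : Pzl 𝕜 α E)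
    (h : 0 ∈ szlenkSet 𝕜 E ε 1 (Ordinal.omega0 ^ α)) (k : ℕ) :
    ∃ (F : Type u) (_ : NormedAddCommGroup F) (_ : NormedSpace 𝕜 F) (_ : CompleteSpace F),
      Pzl 𝕜 α F ∧ 0 ∈ szlenkSet 𝕜 F ε 1 (Ordinal.omega0 ^ α * k) := by
  induction k with
  | zero =>
    refine ⟨ULift.{u} 𝕜, inferInstance, inferInstance, inferInstance, pzl_ulift 𝕜 α, ?_⟩
    simp [szlenkSet, iterDerive_zero, wnorm_zero]
  | succ k ih =>
    obtain ⟨F, _, _, _, hF, h0⟩ := ih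
    refine ⟨WithLp 1 (E × F), inferInstance, inferInstance, inferInstance,
      (hE.prod hF).of_equiv (WithLp.prodContinuousLinearEquiv 1 𝕜 E F), ?_⟩
    rw [Nat.cast_succ, mul_add_one]
    exact zero_mem_szlenkSet_withLp h h0

end LowerBounds

end Szlenk

namespace Szlenk

/-! ### Hilbert sums of spaces -/

section HilbertSum

variable {𝕜 : Type} [RCLike 𝕜] {ι : Type u} [DecidableEq ι] {F : ι → Type u}
  [∀ i, NormedAddCommGroup (F i)] [∀ i, NormedSpace 𝕜 (F i)]

variable (𝕜 F) in
/-- The inclusion of a summand into the `ℓ²`-sum. -/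
noncomputable def incl (i : ι) : F i →L[𝕜] lp F 2 := lp.singleContinuousLinearMap 𝕜 F 2 i

omit [DecidableEq ι] in
variable (𝕜 F) in
/-- The coordinate projection of the `ℓ²`-sum. -/
noncomputable def coord (i : ι) : lp F 2 →L[𝕜] F i := lp.evalCLM 𝕜 F 2 i

variable (𝕜 F) in
/-- The projection of the `ℓ²`-sum onto finitely many summands. -/
noncomputable def proj (s : Finset ι) : lp F 2 →L[𝕜] lp F 2 :=
  ∑ i ∈ s, (incl 𝕜 F i).comp (coord 𝕜 F i)

omit [DecidableEq ι] in
theorem norm_apply_le_norm (x : lp F 2) (i : ι) : ‖x i‖ ≤ ‖x‖ :=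
  lp.norm_apply_le_norm two_ne_zero x i

omit [DecidableEq ι] in
theorem norm_coord_le (i : ι) : ‖coord 𝕜 F i‖ ≤ 1 :=
  ContinuousLinearMap.opNorm_le_bound _ zero_le_one fun x => by
    rw [one_mul]
    exact norm_apply_le_norm x i

theorem norm_incl_apply (i : ι) (x : F i) : ‖incl 𝕜 F i x‖ = ‖x‖ :=
  lp.norm_single (by norm_num) i x

theorem norm_incl_le (i : ι) : ‖incl 𝕜 F i‖ ≤ 1 :=
  ContinuousLinearMap.opNorm_le_bound _ zero_le_one fun x => by
    rw [one_mul, norm_incl_apply]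

theorem coord_incl (i : ι) (x : F i) : coord 𝕜 F i (incl 𝕜 F i x) = x :=
  lp.single_apply_self 2 i x

theorem coord_incl_of_ne {i j : ι} (h : j ≠ i) (x : F i) : coord 𝕜 F j (incl 𝕜 F i x) = 0 :=
  lp.single_apply_ne 2 i x h

theorem proj_apply (s : Finset ι) (x : lp F 2) (j : ι) :
    proj 𝕜 F s x j = if j ∈ s then x j else 0 := by
  have : proj 𝕜 F s x j = coord 𝕜 F j (proj 𝕜 F s x) := rfl
  rw [this, proj, sum_apply, map_sum]
  split_ifs with h
  · rw [Finset.sum_eq_single_of_mem j h fun i _ hij => coord_incl_of_ne hij.symm _]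
    exact coord_incl _ _
  · exact Finset.sum_eq_zero fun i hi => coord_incl_of_ne (by rintro rfl; exact h hi) _

theorem norm_proj_add_sq_le (s : Finset ι) (x y : lp F 2) :
    ‖proj 𝕜 F s x + (y - proj 𝕜 F s y)‖ ^ 2 ≤ ‖x‖ ^ 2 + ‖y‖ ^ 2 := by
  have key : ∀ z : lp F 2, HasSum (fun i => ‖z i‖ ^ 2) (‖z‖ ^ 2) := fun z => by
    have := lp.hasSum_norm (p := 2) (by norm_num) z
    simpa using this
  refine hasSum_le (fun i => ?_) (key _) ((key x).add (key y))
  rw [lp.coeFn_add, lp.coeFn_sub, Pi.add_apply, Pi.sub_apply, proj_apply, proj_apply]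
  split_ifs with h <;> simp

theorem hasSum_incl_coord (x : lp F 2) : HasSum (fun i => incl 𝕜 F i (coord 𝕜 F i x)) x :=
  lp.hasSum_single (by norm_num) x

theorem exists_lt_wnorm_adj_proj {f : WeakDual 𝕜 (lp F 2)} {r : ℝ} (hr : 0 ≤ r)
    (hf : r < wnorm f) : ∃ s, r < wnorm (adj (proj 𝕜 F s) f) := by
  by_contra! h
  refine hf.not_ge (wnorm_le hr fun x => ?_)
  have h1 := ((hasSum_incl_coord (𝕜 := 𝕜) x).mapL (WeakDual.toStrongDual f)).norm
  refine le_of_tendsto h1 (Filter.Eventually.of_forall fun s => ?_)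
  have h2 := (norm_apply_le (adj (proj 𝕜 F s) f) x).trans
    (mul_le_mul_of_nonneg_right (h s) (norm_nonneg x))
  rw [adj_apply, proj, sum_apply, map_sum] at h2
  exact h2

theorem wnorm_adj_proj_le_sum (s : Finset ι) (f : WeakDual 𝕜 (lp F 2)) :
    wnorm (adj (proj 𝕜 F s) f) ≤ ∑ i ∈ s, wnorm (adj (incl 𝕜 F i) f) := by
  refine wnorm_le (Finset.sum_nonneg fun i _ => wnorm_nonneg _) fun x => ?_
  rw [adj_apply, proj, sum_apply, map_sum, Finset.sum_mul]
  refine (norm_sum_le _ _).trans (Finset.sum_le_sum fun i _ => ?_)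
  exact (norm_apply_le (adj (incl 𝕜 F i) f) (x i)).trans
    (mul_le_mul_of_nonneg_left (norm_apply_le_norm x i) (wnorm_nonneg _))

/-- Weighting the tail by `t` gives an operator pair of norm at most `√(1 + t²) ≤ 1 + t² / 2`. Hence
head plus `t` times tail is at most `1 + t² / 2`, and a head above `1 - t² / 2` leaves at most `t²`
for `t` times the tail. -/
theorem wnorm_adj_sub_proj_le {s : Finset ι} {f : WeakDual 𝕜 (lp F 2)} {t : ℝ} (ht : 0 < t)
    (hf : wnorm f ≤ 1) (h : 1 - t ^ 2 / 2 < wnorm (adj (proj 𝕜 F s) f)) :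
    wnorm (adj (ContinuousLinearMap.id 𝕜 _ - proj 𝕜 F s) f) ≤ t := by
  have h1 := wnorm_adj_add_wnorm_adj_le (A := proj 𝕜 F s) (C := 1 + t ^ 2 / 2)
    (B := (t : 𝕜) • (ContinuousLinearMap.id 𝕜 _ - proj 𝕜 F s)) (fun x y hx hy => ?_) f
  · have h2 : adj ((t : 𝕜) • (ContinuousLinearMap.id 𝕜 _ - proj 𝕜 F s)) f =
        (t : 𝕜) • adj (ContinuousLinearMap.id 𝕜 _ - proj 𝕜 F s) f := by
      refine DFunLike.ext _ _ fun x => ?_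
      rw [adj_apply, smul_apply, map_smul]
      rfl
    rw [h2, wnorm_smul, RCLike.norm_ofReal, abs_of_pos ht] at h1
    have h3 : (1 + t ^ 2 / 2) * wnorm f ≤ 1 + t ^ 2 / 2 :=
      mul_le_of_le_one_right (by positivity) hf
    refine le_of_mul_le_mul_left ?_ ht
    nlinarith
  · have h2 : (t : 𝕜) • (ContinuousLinearMap.id 𝕜 (lp F 2) - proj 𝕜 F s) y =
        (t : 𝕜) • y - proj 𝕜 F s ((t : 𝕜) • y) := by
      rw [map_smul, ← smul_sub]
      rfl
    rw [smul_apply, h2]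
    have h3 := norm_proj_add_sq_le (𝕜 := 𝕜) s x ((t : 𝕜) • y)
    rw [norm_smul, RCLike.norm_ofReal, abs_of_pos ht] at h3
    refine abs_le_of_sq_le_sq' (h3.trans ?_) (by positivity) |>.2
    have h4 : ‖x‖ ^ 2 ≤ 1 := pow_le_one₀ (norm_nonneg _) hx
    have h5 : ‖y‖ ^ 2 ≤ 1 := pow_le_one₀ (norm_nonneg _) hy
    nlinarith [sq_nonneg (t ^ 2), mul_le_mul_of_nonneg_left h5 (sq_nonneg t)]

/-- An `ℓ²`-sum of spaces whose dual balls are exhausted by fewer than `ω ^ α` derivations belongs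
to `Pzl₀`. -/
theorem pzl₀_lp [∀ i, CompleteSpace (F i)] {α : Ordinal.{u}}
    (h : ∀ i, ∀ ε > 0, szlenkSet 𝕜 (F i) ε 1 (Ordinal.omega0 ^ α) = ∅) :
    Pzl₀ 𝕜 α (lp F 2) := by
  refine pzl₀_iff.2 ⟨1 / 32, by norm_num, 2, fun ε hε f hf => ?_⟩
  by_contra! hcon
  -- The constant `1 / 32` comes from the tail bound `t = ε / 4`.
  have hr : 1 - (ε / 4) ^ 2 / 2 = 1 - 1 / 32 * ε ^ 2 := by ring
  rw [← hr] at hcon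
  obtain ⟨s, hs⟩ := exists_lt_wnorm_adj_proj (by nlinarith [hε.1, hε.2]) hcon
  have hU : IsOpen {g : WeakDual 𝕜 (lp F 2) | 1 - (ε / 4) ^ 2 / 2 < wnorm (adj (proj 𝕜 F s) g)} :=
    (isOpen_lt_wnorm _).preimage (continuous_adj _)
  have ht : 0 < ε / 4 := by linarith [hε.1]
  -- Near `f` two tails differ by at most `ε / 2`, so an `ε`-far pair has heads more than `ε / 2`
  -- apart; as `s.card * η ≤ ε / 2`, some coordinate in `s` is then `η`-far.
  set η : ℝ := ε / (2 * (s.card + 1)) with hη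
  have hη0 : 0 < η := div_pos hε.1 (by positivity)
  have h1 := mapsTo_iterDerive (r := far ε) (s := fun g k => ∃ i ∈ s,
      far η (adj (incl 𝕜 F i) g) (adj (incl 𝕜 F i) k)) (L := {f | wnorm f ≤ 1}) continuous_id hU
    (fun g hg => hg.1) (fun g hg k hk hgk => ?_) _ ⟨hf, hs⟩
  · obtain ⟨i, -, hi⟩ := exists_mem_iterDerive_of_finset s
      (fun i g k => far η (adj (incl 𝕜 F i) g) (adj (incl 𝕜 F i) k)) h1
    have h2 : adj (incl 𝕜 F i) f ∈ szlenkSet 𝕜 (F i) η 1 (Ordinal.omega0 ^ α) :=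
      mapsTo_iterDerive_univ (continuous_adj _)
        (fun g hg => (wnorm_adj_le_of_le_one (norm_incl_le i) g).trans hg)
        (fun _ _ _ _ => id) _ hi
    rw [h i η hη0] at h2
    exact h2
  · by_contra! hfar
    have hgk' : ε < wnorm (g - k) := hgk
    have hg2 := wnorm_adj_sub_proj_le ht hg.1 hg.2
    have hk2 := wnorm_adj_sub_proj_le ht hk.1 hk.2
    have h2 : wnorm (g - k) ≤ wnorm (adj (proj 𝕜 F s) (g - k)) +
        wnorm (adj (ContinuousLinearMap.id 𝕜 _ - proj 𝕜 F s) (g - k)) := by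
      have h3 : g - k = adj (proj 𝕜 F s) (g - k) +
          adj (ContinuousLinearMap.id 𝕜 _ - proj 𝕜 F s) (g - k) := by
        refine DFunLike.ext _ _ fun x => ?_
        change (g - k) x = (g - k) (proj 𝕜 F s x) + (g - k) (x - proj 𝕜 F s x)
        rw [map_sub (g - k)]
        abel
      conv_lhs => rw [h3]
      exact norm_add_le (E := StrongDual 𝕜 (lp F 2)) _ _
    have h3 := wnorm_sub_le (adj (ContinuousLinearMap.id 𝕜 _ - proj 𝕜 F s) g)
      (adj (ContinuousLinearMap.id 𝕜 _ - proj 𝕜 F s) k)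
    rw [← adj_sub] at h3
    have h4 : wnorm (adj (proj 𝕜 F s) (g - k)) ≤ s.card * η := by
      refine (wnorm_adj_proj_le_sum s _).trans ?_
      rw [← nsmul_eq_mul]
      exact Finset.sum_le_card_nsmul _ _ _ fun i hi => by
        have := hfar i hi
        simpa [far, ← adj_sub] using this
    have h5 : s.card * η ≤ ε / 2 := by
      rw [hη, mul_div_assoc', div_le_div_iff₀ (by positivity) two_pos]
      nlinarith [hε.1]
    linarith

end HilbertSum

variable (𝕜 : Type) [RCLike 𝕜] in
-- The coordinate functionals tend weak-star to `0` but have norm above `1 / 2`.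
theorem zero_mem_szlenkSet_lp_ulift :
    0 ∈ szlenkSet 𝕜 (lp (fun _ : ULift.{u} ℕ => ULift.{u} 𝕜) 2) (1 / 2) 1 (1 : Ordinal.{u}) := by
  classical
  set u : WeakDual 𝕜 (ULift.{u} 𝕜) :=
    StrongDual.toWeakDual (ContinuousLinearEquiv.ulift : ULift.{u} 𝕜 ≃L[𝕜] 𝕜).toContinuousLinearMap
  set e : ULift.{u} ℕ → WeakDual 𝕜 (lp (fun _ : ULift.{u} ℕ => ULift.{u} 𝕜) 2) := fun n =>
    adj (coord 𝕜 (fun _ : ULift.{u} ℕ => ULift.{u} 𝕜) n) u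
  have he : ∀ n x, ‖e n x‖ = ‖x n‖ := fun n x => rfl
  have hle : ∀ n, wnorm (e n) ≤ 1 := fun n => wnorm_le zero_le_one fun x => by
    rw [he, one_mul]
    exact norm_apply_le_norm x n
  have hlt : ∀ n, 1 / 2 < wnorm (e n) := fun n => by
    have h1 := norm_apply_le (e n) (incl 𝕜 (fun _ : ULift.{u} ℕ => ULift.{u} 𝕜) n (ULift.up 1))
    rw [norm_incl_apply, he] at h1
    have h2 : incl 𝕜 (fun _ : ULift.{u} ℕ => ULift.{u} 𝕜) n (ULift.up 1) n = ULift.up 1 :=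
      coord_incl (𝕜 := 𝕜) (F := fun _ : ULift.{u} ℕ => ULift.{u} 𝕜) n _
    have h3 : ‖(ULift.up 1 : ULift.{u} 𝕜)‖ = 1 := norm_one (α := 𝕜)
    rw [h2, h3] at h1
    linarith
  have hlim : Filter.Tendsto e Filter.cofinite (nhds 0) := by
    refine (WeakBilin.tendsto_iff_forall_eval_tendsto (topDualPairing 𝕜 _)
      ContinuousLinearMap.coe_injective).2 ?_
    intro x
    have h1 : Summable fun n => ‖x n‖ ^ 2 := by
      have := (lp.hasSum_norm (p := 2) (by norm_num) x).summable
      simpa using this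
    have h2 := h1.tendsto_cofinite_zero.sqrt
    simp only [Real.sqrt_sq (norm_nonneg _), Real.sqrt_zero] at h2
    exact tendsto_zero_iff_norm_tendsto_zero.2 h2
  rw [szlenkSet, iterDerive_one]
  refine ⟨by simp [wnorm_zero], fun V hV h0 => ?_⟩
  obtain ⟨n, hn⟩ := (hlim.eventually (hV.mem_nhds h0)).exists
  refine ⟨e n, ⟨hle n, hn⟩, 0, ⟨by simp [wnorm_zero], h0⟩, ?_⟩
  change 1 / 2 < wnorm (e n - 0)
  rw [sub_zero]
  exact hlt n

end Szlenk

/-! ### Surviving dual balls at every ordinal and failure of closedness -/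

namespace Szlenk

variable (𝕜 : Type) [RCLike 𝕜]

/-- There are spaces in `Pzl₀` whose dual ball is not exhausted by `ω ^ α` derivations. -/
theorem exists_pzl₀_zero_mem (α : Ordinal.{u}) :
    ∃ (E : Type u) (_ : NormedAddCommGroup E) (_ : NormedSpace 𝕜 E) (_ : CompleteSpace E),
      Pzl₀ 𝕜 α E ∧ 0 ∈ szlenkSet 𝕜 E (1 / 2) 1 (Ordinal.omega0 ^ α) := by
  classical
  induction α using WellFoundedLT.induction with
  | ind α ih =>
  rcases eq_or_ne α 0 with rfl | hα
  · refine ⟨lp (fun _ : ULift.{u} ℕ => ULift.{u} 𝕜) 2, inferInstance, inferInstance,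
      inferInstance, pzl₀_lp fun _ ε hε => szlenkSet_ulift_eq_empty 𝕜 hε 0, ?_⟩
    rw [Ordinal.opow_zero]
    exact zero_mem_szlenkSet_lp_ulift 𝕜
  -- The ordinals `ω ^ c * n` with `c < α` are cofinal in `ω ^ α`. `Shrink` brings the index set of
  -- pairs `(c, n)` down to universe `u`.
  have hF : ∀ i : Shrink.{u} (Iio α × ℕ), ∃ (F : Type u) (_ : NormedAddCommGroup F)
      (_ : NormedSpace 𝕜 F) (_ : CompleteSpace F),
      Pzl 𝕜 ((equivShrink _).symm i).1.1 F ∧ 0 ∈ szlenkSet 𝕜 F (1 / 2) 1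
        (Ordinal.omega0 ^ ((equivShrink _).symm i).1.1 * ((equivShrink _).symm i).2) := by
    intro i
    obtain ⟨E, _, _, _, hE, h0⟩ := ih _ ((equivShrink _).symm i).1.2
    exact exists_pzl_zero_mem_mul hE.pzl h0 _
  choose F _ _ _ hF h0 using hF
  refine ⟨lp F 2, inferInstance, inferInstance, inferInstance,
    pzl₀_lp fun i ε hε => (hF i).szlenkSet_eq_empty ((equivShrink _).symm i).1.2 hε, ?_⟩
  by_contra hcon
  obtain ⟨c, hc, n, hn⟩ := iterDerive_limit_notMem hα hcon
  have h := h0 (equivShrink _ (⟨c, hc⟩, n))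
  simp only [Equiv.symm_apply_apply] at h
  exact hn (zero_mem_szlenkSet_of_retract (norm_coord_le (𝕜 := 𝕜) _) (norm_incl_le _)
    (coord_incl _) h)

theorem not_isClosedClass_op_pzl (α : Ordinal.{u}) : ¬ IsClosedClass (Op (Pzl 𝕜 α)) := by
  classical
  intro hclosed
  have hF : ∀ i : ULift.{u} ℕ, ∃ (F : Type u) (_ : NormedAddCommGroup F)
      (_ : NormedSpace 𝕜 F) (_ : CompleteSpace F), Pzl 𝕜 α F ∧
        0 ∈ szlenkSet 𝕜 F (1 / 2) 1 (Ordinal.omega0 ^ α * (2 ^ (i.down * i.down) : ℕ)) := by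
    intro i
    obtain ⟨E, _, _, _, hE, h0⟩ := exists_pzl₀_zero_mem 𝕜 α
    exact exists_pzl_zero_mem_mul hE.pzl h0 _
  choose F _ _ _ hF h0 using hF
  set V : ULift.{u} ℕ → (lp F 2 →L[𝕜] lp F 2) := fun i =>
    ((((1 / 2 : ℝ) ^ i.down : ℝ) : 𝕜) • incl 𝕜 F i).comp (coord 𝕜 F i) with hV
  have hVn : ∀ i, ‖V i‖ ≤ (1 / 2 : ℝ) ^ i.down := by
    intro i
    refine (ContinuousLinearMap.opNorm_comp_le _ _).trans ?_
    rw [norm_smul, RCLike.norm_ofReal, abs_of_pos (by positivity), mul_assoc]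
    exact mul_le_of_le_one_right (by positivity)
      (mul_le_one₀ (norm_incl_le i) (norm_nonneg _) (norm_coord_le i))
  have hsum : Summable V :=
    Summable.of_norm_bounded ((Equiv.ulift.{u}.summable_iff).2 summable_geometric_two) hVn
  have hmem : ∑' i, V i ∈ Op (Pzl 𝕜 α) (lp F 2) (lp F 2) := by
    refine (hclosed (lp F 2) (lp F 2)).mem_of_tendsto hsum.hasSum
      (Filter.Eventually.of_forall fun s => ?_)
    induction s using Finset.induction_on with
    | empty => exact ⟨ULift.{u} 𝕜, _, _, inferInstance, 0, 0, pzl_ulift 𝕜 α, by simp⟩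
    | insert i s hi ih =>
      rw [Finset.sum_insert hi]
      exact (isOperatorIdeal_op_pzl 𝕜 α).add_mem _ _ _ _
        ⟨F i, _, _, inferInstance, coord 𝕜 F i, _, hF i, rfl⟩ ih
  obtain ⟨D, _, _, _, A, B, hD, hT⟩ := hmem
  obtain ⟨M, N, h⟩ := hD.exists_szlenkSet_eq_empty (‖A‖ + ‖B‖) (ε := 1 / 2) (by norm_num)
  obtain ⟨m, hm⟩ := exists_nat_ge M
  -- Here `2 ^ (i²) * 2 ^ (-i N) = 2 ^ ((N + m) m)`, which is at least `m ≥ M`.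
  set i : ULift.{u} ℕ := ULift.up (N + m) with hi
  have hempty := h (F i) (A.comp (incl 𝕜 F i)) ((coord 𝕜 F i).comp B) ((1 / 2 : ℝ) ^ i.down)
    (by positivity) (pow_le_one₀ (by norm_num) (by norm_num)) ?_ ?_ (fun x => ?_)
    (2 ^ (i.down * i.down)) ?_
  · have := h0 i
    rw [hempty] at this
    exact this
  · refine (ContinuousLinearMap.opNorm_comp_le _ _).trans ?_
    have := mul_le_of_le_one_right (norm_nonneg A) (norm_incl_le (𝕜 := 𝕜) (F := F) i)
    linarith [norm_nonneg B]
  · refine (ContinuousLinearMap.opNorm_comp_le _ _).trans ?_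
    have := mul_le_of_le_one_left (norm_nonneg B) (norm_coord_le (𝕜 := 𝕜) (F := F) i)
    linarith [norm_nonneg A]
  -- Only the `i`-th term of the series acts on the `i`-th summand, so `T` compresses there to `2 ^
  -- (-i)` times the identity.
  · have h1 := hsum.hasSum.mapL
      ((coord 𝕜 F i).comp (ContinuousLinearMap.apply 𝕜 (lp F 2) (incl 𝕜 F i x)))
    have h2 : (coord 𝕜 F i).comp (ContinuousLinearMap.apply 𝕜 (lp F 2) (incl 𝕜 F i x)) (V i) =
        (((1 / 2 : ℝ) ^ i.down : ℝ) : 𝕜) • x := by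
      change coord 𝕜 F i ((((1 / 2 : ℝ) ^ i.down : ℝ) : 𝕜) •
        incl 𝕜 F i (coord 𝕜 F i (incl 𝕜 F i x))) = _
      rw [map_smul, coord_incl, coord_incl]
    rw [← h2, ← h1.unique (hasSum_single i fun j hj => ?_), hT]
    · rfl
    · change coord 𝕜 F i ((((1 / 2 : ℝ) ^ j.down : ℝ) : 𝕜) •
        incl 𝕜 F j (coord 𝕜 F j (incl 𝕜 F i x))) = _
      rw [coord_incl_of_ne hj, map_zero, smul_zero, map_zero]
  · refine hm.trans ?_
    have h1 : ((2 ^ (i.down * i.down) : ℕ) : ℝ) * ((1 / 2 : ℝ) ^ i.down) ^ N =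
        2 ^ ((N + m) * m) := by
      rw [hi, ← pow_mul, Nat.cast_pow, Nat.cast_ofNat, mul_add, pow_add, one_div, inv_pow,
        mul_right_comm, mul_inv_cancel₀ (by positivity), one_mul]
    rw [h1]
    have h2 : m < 2 ^ m := Nat.lt_two_pow_self
    have h3 : 2 ^ m ≤ 2 ^ ((N + m) * m) := by
      refine Nat.pow_le_pow_right (by norm_num) ?_
      nlinarith [Nat.zero_le N, Nat.zero_le (N * m), Nat.le_mul_self m]
    exact_mod_cast h2.le.trans h3

end Szlenk

theorem theorem5p8 (𝕜 : Type) [RCLike 𝕜] (α : Ordinal.{u}) :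
    Szlenk.IsOperatorIdeal (Szlenk.Op (Szlenk.Pzl 𝕜 α)) ∧
      ¬ Szlenk.IsClosedClass (Szlenk.Op (Szlenk.Pzl 𝕜 α)) :=
  ⟨Szlenk.isOperatorIdeal_op_pzl 𝕜 α, Szlenk.not_isClosedClass_op_pzl 𝕜 α⟩
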